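/- **Lemma.** There is a function $C(k,s,d,\delta)>0$ (defined for $k,s,d\in\mathbb N$, $d\ge 1$, $\delta>0$), with $$C(1,1,d,\delta)=2\sqrt{d(d+2)}\,\delta^{-1-d/2},$$ such that the following holds. Let $k,s,d\in\mathbb N$, $d\ge1$, $\delta>0$, $h>0$, and let $\Omega_h\subset\mathbb R^d$ be a bounded open set of diameter at most $h$ that contains an open ball of radius $\delta h/2$ (no regularity of $\partial\Omega_h$ is needed). Let $H_0^k(\Omega_h)$ be the closure of $C_c^\infty(\Omega_h)$ in the Sobolev space $H^k(\Omega_h)$, and let $|u|_{k,2,\Omega_h}=\bigl(\sum_{|\sigma|=k}\|D^\sigma u\|_{L^2(\Omega_h)}^2\bigr)^{1/2}$. Let $p$ be a real polynomial in $d$ variables of degree less than $s$, and let $u_h=\mathcal L^{-1}p$ be the weak solution of $$\mathcal L u_h:=(-1)^k\sum_{|\sigma|=k}D^{2\sigma}u_h=p\ \text{ in }\Omega_h,\qquad u_h\in H_0^k(\Omega_h),$$ that is, $\sum_{|\sigma|=k}\int_{\Omega_h}D^\sigma u_h\,D^\sigma\varphi=\int_{\Omega_h}p\,\varphi$ for all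 $\varphi\in C_c^\infty(\Omega_h)$. Then $$\|\mathcal L u_h\|_{L^2(\Omega_h)}=\|p\|_{L^2(\Omega_h)}\le C(k,s,d,\delta)\,h^{-k}\,|u_h|_{k,2,\Omega_h}.$$ In particular the constant depends on $\Omega_h$ and $h$ only through $\delta$ as indicated. -/

import Mathlib

open MeasureTheory Filter Topology
open scoped ContDiff

/-- The multi-indices `σ ∈ ℕ^d` of order `|σ| = σ₁ + ⋯ + σ_d = k`. -/
def multiIndices (d k : ℕ) : Finset (Fin d → ℕ) :=
  Finset.Nat.antidiagonalTuple d k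

theorem mem_multiIndices {d k : ℕ} {σ : Fin d → ℕ} :
    σ ∈ multiIndices d k ↔ ∑ i, σ i = k :=
  Finset.Nat.mem_antidiagonalTuple

/-- The classical partial derivative `∂f/∂x_i`. -/
noncomputable def partialDeriv {d : ℕ} (i : Fin d) (f : EuclideanSpace ℝ (Fin d) → ℝ) :
    EuclideanSpace ℝ (Fin d) → ℝ :=
  fun x => fderiv ℝ f x (EuclideanSpace.single i 1)

/-- The classical mixed derivative `D^σ f = ∂₁^{σ₁} ⋯ ∂_d^{σ_d} f`. -/
noncomputable def mixedDeriv {d : ℕ} (σ : Fin d → ℕ) (f : EuclideanSpace ℝ (Fin d) → ℝ) :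
    EuclideanSpace ℝ (Fin d) → ℝ :=
  (List.finRange d).foldr (fun i g => (partialDeriv i)^[σ i] g) f

/-- Test functions: `φ ∈ C_c^∞(Ω)`. -/
def IsTestFunction {d : ℕ} (Ω : Set (EuclideanSpace ℝ (Fin d)))
    (φ : EuclideanSpace ℝ (Fin d) → ℝ) : Prop :=
  ContDiff ℝ ∞ φ ∧ HasCompactSupport φ ∧ tsupport φ ⊆ Ω

/-- `g` is a weak derivative `D^σ u` of `u` on the open set `Ω`. -/
def HasWeakDeriv {d : ℕ} (Ω : Set (EuclideanSpace ℝ (Fin d))) (σ : Fin d → ℕ)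
    (u g : EuclideanSpace ℝ (Fin d) → ℝ) : Prop :=
  LocallyIntegrableOn u Ω ∧ LocallyIntegrableOn g Ω ∧
    ∀ φ, IsTestFunction Ω φ →
      ∫ x in Ω, u x * mixedDeriv σ φ x = (-1) ^ (∑ i, σ i) * ∫ x in Ω, g x * φ x

/-- Weak derivatives are unique up to null sets. -/
theorem HasWeakDeriv.ae_unique {d : ℕ} {Ω : Set (EuclideanSpace ℝ (Fin d))} (hΩ : IsOpen Ω)
    {σ : Fin d → ℕ} {u g₁ g₂ : EuclideanSpace ℝ (Fin d) → ℝ}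
    (h₁ : HasWeakDeriv Ω σ u g₁) (h₂ : HasWeakDeriv Ω σ u g₂) :
    g₁ =ᵐ[volume.restrict Ω] g₂ := by
  have key : ∀ᵐ x ∂(volume : Measure (EuclideanSpace ℝ (Fin d))), x ∈ Ω → (g₁ - g₂) x = 0 := by
    refine hΩ.ae_eq_zero_of_integral_contDiff_smul_eq_zero (h₁.2.1.sub h₂.2.1) ?_
    intro φ hφ hc hs
    have int : ∀ g : EuclideanSpace ℝ (Fin d) → ℝ, LocallyIntegrableOn g Ω →
        Integrable (fun x => g x * φ x) (volume.restrict Ω) := by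
      intro g hg
      have h1 : IntegrableOn g (tsupport φ) :=
        (hg.mono_set hs).integrableOn_isCompact hc
      have h2 : IntegrableOn (fun x => g x * φ x) (tsupport φ) :=
        h1.mul_continuousOn hφ.continuous.continuousOn hc
      have h3 : Integrable (fun x => g x * φ x) := by
        refine (integrableOn_iff_integrable_of_support_subset ?_).1 h2
        exact (Function.support_mul_subset_right _ _).trans (subset_tsupport φ)
      exact h3.integrableOn
    have e := (h₁.2.2 φ ⟨hφ, hc, hs⟩).symm.trans (h₂.2.2 φ ⟨hφ, hc, hs⟩)
    have e' : ∫ x in Ω, g₁ x * φ x = ∫ x in Ω, g₂ x * φ x :=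
      mul_left_cancel₀ (pow_ne_zero _ (by norm_num)) e
    have h0 : ∫ x in Ω, φ x • (g₁ - g₂) x = 0 := by
      have : (fun x => φ x • (g₁ - g₂) x) = fun x => g₁ x * φ x - g₂ x * φ x := by
        funext x; simp [mul_comm, mul_sub]
      rw [this, integral_sub (int g₁ h₁.2.1) (int g₂ h₂.2.1), e', sub_self]
    rw [← h0, setIntegral_eq_integral_of_forall_compl_eq_zero]
    intro x hx
    rw [image_eq_zero_of_notMem_tsupport (fun h => hx (hs h)), zero_smul]
  rw [EventuallyEq, ae_restrict_iff' hΩ.measurableSet]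
  filter_upwards [key] with x hx hxΩ
  exact sub_eq_zero.1 (hx hxΩ)

open Classical in
/-- The weak derivative `D^σ u` on `Ω` (well defined up to null sets; `0` if there is none). -/
noncomputable def weakDeriv {d : ℕ} (Ω : Set (EuclideanSpace ℝ (Fin d))) (σ : Fin d → ℕ)
    (u : EuclideanSpace ℝ (Fin d) → ℝ) : EuclideanSpace ℝ (Fin d) → ℝ :=
  if h : ∃ g, HasWeakDeriv Ω σ u g then h.choose else 0

theorem HasWeakDeriv.weakDeriv_spec {d : ℕ} {Ω : Set (EuclideanSpace ℝ (Fin d))}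
    {σ : Fin d → ℕ} {u g : EuclideanSpace ℝ (Fin d) → ℝ} (h : HasWeakDeriv Ω σ u g) :
    HasWeakDeriv Ω σ u (weakDeriv Ω σ u) := by
  have h' : ∃ g, HasWeakDeriv Ω σ u g := ⟨g, h⟩
  rw [weakDeriv, dif_pos h']
  exact h'.choose_spec

/-- The Sobolev space `H^k(Ω)`: `u ∈ L²(Ω)`, with weak derivatives of all orders `≤ k`
in `L²(Ω)`. -/
def MemSobolev {d : ℕ} (Ω : Set (EuclideanSpace ℝ (Fin d))) (k : ℕ)
    (u : EuclideanSpace ℝ (Fin d) → ℝ) : Prop :=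
  MemLp u 2 (volume.restrict Ω) ∧
    ∀ σ : Fin d → ℕ, ∑ i, σ i ≤ k →
      ∃ g, HasWeakDeriv Ω σ u g ∧ MemLp g 2 (volume.restrict Ω)

/-- The space `H_0^k(Ω)`: the closure of `C_c^∞(Ω)` in `H^k(Ω)`. -/
def MemSobolevZero {d : ℕ} (Ω : Set (EuclideanSpace ℝ (Fin d))) (k : ℕ)
    (u : EuclideanSpace ℝ (Fin d) → ℝ) : Prop :=
  MemSobolev Ω k u ∧
    ∃ φ : ℕ → EuclideanSpace ℝ (Fin d) → ℝ, (∀ n, IsTestFunction Ω (φ n)) ∧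
      ∀ σ : Fin d → ℕ, ∑ i, σ i ≤ k →
        Tendsto (fun n => eLpNorm (weakDeriv Ω σ u - mixedDeriv σ (φ n)) 2 (volume.restrict Ω))
          atTop (𝓝 0)

/-- The norm `‖f‖_{L²(Ω)}` of `f ∈ L²(Ω)`. -/
noncomputable def l2Norm {d : ℕ} (Ω : Set (EuclideanSpace ℝ (Fin d)))
    (f : EuclideanSpace ℝ (Fin d) → ℝ) : ℝ :=
  Real.sqrt (∫ x in Ω, f x ^ 2)

/-- The seminorm `|u|_{k,2,Ω} = (∑_{|σ| = k} ∫_Ω |D^σ u|²)^{1/2}` of `u ∈ H^k(Ω)`. -/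
noncomputable def sobolevSeminorm {d : ℕ} (Ω : Set (EuclideanSpace ℝ (Fin d))) (k : ℕ)
    (u : EuclideanSpace ℝ (Fin d) → ℝ) : ℝ :=
  Real.sqrt (∑ σ ∈ multiIndices d k, ∫ x in Ω, weakDeriv Ω σ u x ^ 2)

/-- `u` is the weak solution of `(-1)^k ∑_{|σ| = k} D^{2σ} u = f` in `Ω` with the homogeneous
Dirichlet condition, that is `u ∈ H_0^k(Ω)` and
`∑_{|σ| = k} ∫_Ω D^σ u D^σ φ = ∫_Ω f φ` for all `φ ∈ C_c^∞(Ω)`. -/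
def IsDirichletSolution {d : ℕ} (Ω : Set (EuclideanSpace ℝ (Fin d))) (k : ℕ)
    (u f : EuclideanSpace ℝ (Fin d) → ℝ) : Prop :=
  MemSobolevZero Ω k u ∧
    ∀ φ, IsTestFunction Ω φ →
      ∑ σ ∈ multiIndices d k, ∫ x in Ω, weakDeriv Ω σ u x * mixedDeriv σ φ x =
        ∫ x in Ω, f x * φ x

/-! Test the equation with `p` times a cut-off supported in the inscribed ball. Cauchy–Schwarz
bounds the cut-off weighted integral of `p ^ 2` by the seminorm of `u` times that of the test
function (`IsDirichletSolution.abs_integral_mul_le`). After rescaling by `h`, polynomials of bounded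
degree form a fixed finite-dimensional space, on which the weighted integral controls both the
seminorm of the test function and the norm on the unit ball, which contains the rescaled domain
(`exists_cutoff_bound`). The powers of `h` combine to `h ^ (-k)`.

Compactness gives no explicit constant, so `k = s = 1` is treated apart. There `p` is a constant,
the test function is a smoothed paraboloid `r ^ 2 - ‖x - x₀‖ ^ 2` on the inscribed ball, and its
integrals are computed exactly. The stated constant also needs the sharp bound of `volume Ω` by the
volume of a ball of diameter `h`: the isodiametric inequality, proved by Steiner symmetrization. -/

/-! ### Isodiametric inequality -/

/-- The Steiner symmetrization of a set `A ⊆ ℝ^ι` in the direction of the `i`-th axis. -/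
def steiner {ι : Type*} [DecidableEq ι] (i : ι) (A : Set (ι → ℝ)) : Set (ι → ℝ) :=
  {x | ENNReal.ofReal (2 * |x i|) < volume {t | Function.update x i t ∈ A}}

theorem lmarginal_singleton_indicator {ι : Type*} [DecidableEq ι] (i : ι) {A : Set (ι → ℝ)}
    (hA : MeasurableSet A) :
    (∫⋯∫⁻_{i}, A.indicator 1 ∂(fun _ => (volume : Measure ℝ))) =
      fun x => volume {t | Function.update x i t ∈ A} := by
  rw [lmarginal_singleton]
  funext x
  have hm : MeasurableSet {t | Function.update x i t ∈ A} := (measurable_update x) hA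
  rw [← lintegral_indicator_one hm]
  rfl

theorem measurableSet_steiner {ι : Type*} [DecidableEq ι] (i : ι) {A : Set (ι → ℝ)}
    (hA : MeasurableSet A) : MeasurableSet (steiner i A) := by
  have h : Measurable (fun x : ι → ℝ => volume {t | Function.update x i t ∈ A}) := by
    rw [← lmarginal_singleton_indicator i hA]
    exact (measurable_one.indicator hA).lmarginal _
  refine measurableSet_lt ?_ h
  fun_prop

theorem volume_ofReal_two_mul_abs_lt (m : ENNReal) :
    volume {t : ℝ | ENNReal.ofReal (2 * |t|) < m} = m := by
  rcases eq_or_ne m ⊤ with rfl | hm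
  · simp only [ENNReal.ofReal_lt_top, Set.ofPred_true, Real.volume_univ]
  · have : {t : ℝ | ENNReal.ofReal (2 * |t|) < m} = Metric.ball 0 (m.toReal / 2) := by
      ext t
      rw [Set.mem_ofPred_eq, ENNReal.ofReal_lt_iff_lt_toReal (by positivity) hm, Metric.mem_ball,
        dist_zero_right, Real.norm_eq_abs, lt_div_iff₀ two_pos, mul_comm]
    rw [this, Real.volume_ball, mul_div_cancel₀ _ two_ne_zero, ENNReal.ofReal_toReal hm]

/-- Fubini along the `i`-th axis: each section is replaced by a centred interval of the same length.
-/
theorem volume_steiner {ι : Type*} [DecidableEq ι] [Fintype ι] (i : ι) {A : Set (ι → ℝ)}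
    (hA : MeasurableSet A) : volume (steiner i A) = volume A := by
  have hS := measurableSet_steiner i hA
  rw [← lintegral_indicator_one hA, ← lintegral_indicator_one hS, volume_pi]
  refine lintegral_eq_of_lmarginal_eq {i} (measurable_one.indicator hS)
    (measurable_one.indicator hA) ?_
  rw [lmarginal_singleton_indicator i hA, lmarginal_singleton_indicator i hS]
  funext x
  simp only [steiner, Set.mem_ofPred_eq, Function.update_idem, Function.update_self]
  exact volume_ofReal_two_mul_abs_lt _

/-- A set of reals of measure larger than `c` contains two points at distance larger than `c`. -/
theorem exists_lt_sub_of_lt_volume {X : Set ℝ} {c : ℝ}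
    (h : ENNReal.ofReal c < volume X) : ∃ a ∈ X, ∃ b ∈ X, c < b - a := by
  by_contra! hcon
  refine h.not_ge ((Real.volume_le_diam X).trans (Metric.ediam_le fun x hx y hy => ?_))
  rw [edist_dist, Real.dist_eq]
  exact ENNReal.ofReal_le_ofReal (abs_le.2 ⟨by linarith [hcon x hx y hy], hcon y hy x hx⟩)

/-- The sections of `A` through `x` and `y` contain pairs `a, b` and `a', b'` with gaps above `2 *
|x i|` and `2 * |y i|`. Since `(b - a') + (b' - a)` exceeds `2 * (|x i| + |y i|)`, one summand is at
least `|x i| + |y i|`, and moving the `i`-th coordinates there gives points of `A` at least as far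
apart as `x` and `y`. -/
theorem sum_sq_sub_le_of_steiner {ι : Type*} [DecidableEq ι] [Fintype ι] (i : ι)
    {A : Set (ι → ℝ)} {c : ℝ} (hA : ∀ x ∈ A, ∀ y ∈ A, ∑ j, (x j - y j) ^ 2 ≤ c) :
    ∀ x ∈ steiner i A, ∀ y ∈ steiner i A, ∑ j, (x j - y j) ^ 2 ≤ c := by
  intro x hx y hy
  obtain ⟨a, ha, b, hb, hab⟩ := exists_lt_sub_of_lt_volume hx
  obtain ⟨a', ha', b', hb', hab'⟩ := exists_lt_sub_of_lt_volume hy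
  have key : ∀ t ∈ {t | Function.update x i t ∈ A}, ∀ s ∈ {t | Function.update y i t ∈ A},
      |x i| + |y i| ≤ t - s ∨ |x i| + |y i| ≤ s - t → ∑ j, (x j - y j) ^ 2 ≤ c := by
    intro t ht s hs hts
    refine le_trans (Finset.sum_le_sum fun j _ => ?_) (hA _ ht _ hs)
    by_cases hj : j = i
    · subst hj
      simp only [Function.update_self]
      have h2 : |x j| + |y j| ≤ |t - s| := by
        rcases hts with h | h
        · exact h.trans (le_abs_self _)
        · exact h.trans ((le_abs_self _).trans_eq (abs_sub_comm _ _))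
      exact sq_le_sq.2 ((abs_sub _ _).trans h2)
    · simp [hj]
  rcases le_total (|x i| + |y i|) (b - a') with h | h
  · exact key b hb a' ha' (Or.inl h)
  · exact key a ha b' hb' (Or.inr (by linarith))

theorem update_neg_mem_steiner {ι : Type*} [DecidableEq ι] (i : ι) (A : Set (ι → ℝ))
    {x : ι → ℝ} (hx : x ∈ steiner i A) : Function.update x i (-x i) ∈ steiner i A := by
  simpa [steiner] using hx

/-- Reflecting in `j` maps the `i`-section through `x` into the one through the reflected point, so
later symmetrizations keep the symmetries already gained. -/
theorem update_neg_mem_steiner_of_ne {ι : Type*} [DecidableEq ι] {i j : ι} (hij : i ≠ j)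
    {A : Set (ι → ℝ)} (hA : ∀ x ∈ A, Function.update x j (-x j) ∈ A)
    {x : ι → ℝ} (hx : x ∈ steiner i A) : Function.update x j (-x j) ∈ steiner i A := by
  simp only [steiner, Set.mem_ofPred_eq, Function.update_of_ne hij] at hx ⊢
  refine hx.trans_le (measure_mono fun t ht => ?_)
  have := hA _ ht
  rwa [Function.update_of_ne hij.symm, Function.update_comm hij] at this

theorem exists_symmetric_rearrangement {ι : Type*} [DecidableEq ι] [Fintype ι] {A : Set (ι → ℝ)}
    (hA : MeasurableSet A) {c : ℝ} (hc : ∀ x ∈ A, ∀ y ∈ A, ∑ j, (x j - y j) ^ 2 ≤ c)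
    (s : Finset ι) : ∃ B : Set (ι → ℝ), MeasurableSet B ∧ volume B = volume A ∧
      (∀ x ∈ B, ∀ y ∈ B, ∑ j, (x j - y j) ^ 2 ≤ c) ∧
      ∀ x ∈ B, ∀ j ∈ s, Function.update x j (-x j) ∈ B := by
  induction s using Finset.induction_on with
  | empty => exact ⟨A, hA, rfl, hc, by simp⟩
  | insert i s hi ih =>
    obtain ⟨B, hB, hv, hd, hs⟩ := ih
    refine ⟨steiner i B, measurableSet_steiner i hB, (volume_steiner i hB).trans hv,
      sum_sq_sub_le_of_steiner i hd, fun x hx j hj => ?_⟩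
    by_cases hij : i = j
    · subst hij
      exact update_neg_mem_steiner i B hx
    · have hjs : j ∈ s := (Finset.mem_insert.1 hj).resolve_left (Ne.symm hij)
      exact update_neg_mem_steiner_of_ne hij (fun x hx => hs x hx j hjs) hx

theorem neg_mem_of_update_neg_mem {ι : Type*} [DecidableEq ι] [Fintype ι] {B : Set (ι → ℝ)}
    (hB : ∀ x ∈ B, ∀ j, Function.update x j (-x j) ∈ B) {x : ι → ℝ} (hx : x ∈ B) : -x ∈ B := by
  have key : ∀ s : Finset ι, (fun j => if j ∈ s then -x j else x j) ∈ B := by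
    intro s
    induction s using Finset.induction_on with
    | empty => simpa using hx
    | insert i s hi ih =>
      have := hB _ ih i
      convert this using 1
      funext j
      by_cases hj : j = i
      · subst hj; simp [hi]
      · simp [hj]
  have := key Finset.univ
  simp only [Finset.mem_univ, if_true] at this
  exact this

/-- The **isodiametric inequality**. -/
theorem volume_le_volume_closedBall_half {d : ℕ} {A : Set (EuclideanSpace ℝ (Fin d))}
    (hA : MeasurableSet A) {h : ℝ} (hh : 0 ≤ h) (hd : ∀ x ∈ A, ∀ y ∈ A, dist x y ≤ h) :
    volume A ≤ volume (Metric.closedBall (0 : EuclideanSpace ℝ (Fin d)) (h / 2)) := by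
  have mp := PiLp.volume_preserving_toLp (Fin d)
  have hA' : MeasurableSet (WithLp.toLp 2 ⁻¹' A : Set (Fin d → ℝ)) := mp.measurable hA
  obtain ⟨B, hB, hv, hdB, hs⟩ := exists_symmetric_rearrangement hA' (c := h ^ 2)
    (fun x hx y hy => by
      have := hd _ hx _ hy
      rw [EuclideanSpace.dist_eq, Real.sqrt_le_left hh] at this
      simpa [Real.dist_eq, sq_abs] using this) Finset.univ
  rw [← mp.measure_preimage hA.nullMeasurableSet, ← hv,
    ← mp.measure_preimage Metric.isClosed_closedBall.measurableSet.nullMeasurableSet]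
  refine measure_mono fun x hx => ?_
  -- Symmetry in every coordinate makes `B` centrally symmetric, so `x` and `-x` are at distance `2
  -- * ‖x‖ ≤ h`.
  have h1 := hdB x hx (-x) (neg_mem_of_update_neg_mem (fun x hx j => hs x hx j (Finset.mem_univ j)) hx)
  have h2 : ∑ j, (x j - (-x) j) ^ 2 = 4 * ∑ j, x j ^ 2 := by
    rw [Finset.mul_sum]
    refine Finset.sum_congr rfl fun j _ => ?_
    rw [Pi.neg_apply]; ring
  rw [Set.mem_preimage, mem_closedBall_zero_iff, EuclideanSpace.norm_eq,
    Real.sqrt_le_left (by positivity)]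
  simp only [Real.norm_eq_abs, sq_abs]
  nlinarith

/-! ### Calculus of mixed derivatives -/

/-- Stated for an arbitrary list, since the induction cannot run on `List.finRange d` itself. -/
theorem foldr_iterate_induction {α β : Type*} (P : β → Prop) (D : α → β → β) (σ : α → ℕ)
    (hD : ∀ i f, P f → P (D i f)) {f : β} (hf : P f) (l : List α) :
    P (l.foldr (fun i g => (D i)^[σ i] g) f) := by
  induction l with
  | nil => exact hf
  | cons i l ih =>
    rw [List.foldr_cons]
    exact Function.Iterate.rec P ih (fun g hg => hD i g hg) (σ i)

theorem mixedDeriv_induction {d : ℕ} (P : (EuclideanSpace ℝ (Fin d) → ℝ) → Prop)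
    (hP : ∀ i f, P f → P (partialDeriv i f)) (σ : Fin d → ℕ)
    {f : EuclideanSpace ℝ (Fin d) → ℝ} (hf : P f) : P (mixedDeriv σ f) :=
  foldr_iterate_induction P partialDeriv σ hP hf _

theorem ContDiff.partialDeriv {d : ℕ} {f : EuclideanSpace ℝ (Fin d) → ℝ} (hf : ContDiff ℝ ∞ f)
    (i : Fin d) : ContDiff ℝ ∞ (partialDeriv i f) :=
  (hf.fderiv_right (by simp)).clm_apply contDiff_const

theorem ContDiff.mixedDeriv {d : ℕ} {f : EuclideanSpace ℝ (Fin d) → ℝ} (hf : ContDiff ℝ ∞ f)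
    (σ : Fin d → ℕ) : ContDiff ℝ ∞ (mixedDeriv σ f) :=
  mixedDeriv_induction (ContDiff ℝ ∞) (fun i _ h => h.partialDeriv i) σ hf

theorem HasCompactSupport.partialDeriv {d : ℕ} {f : EuclideanSpace ℝ (Fin d) → ℝ}
    (hf : HasCompactSupport f) (i : Fin d) : HasCompactSupport (partialDeriv i f) :=
  hf.fderiv_apply ℝ _

theorem HasCompactSupport.mixedDeriv {d : ℕ} {f : EuclideanSpace ℝ (Fin d) → ℝ}
    (hf : HasCompactSupport f) (σ : Fin d → ℕ) : HasCompactSupport (mixedDeriv σ f) :=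
  mixedDeriv_induction HasCompactSupport (fun i _ h => h.partialDeriv i) σ hf

theorem tsupport_partialDeriv_subset {d : ℕ} (f : EuclideanSpace ℝ (Fin d) → ℝ) (i : Fin d) :
    tsupport (partialDeriv i f) ⊆ tsupport f :=
  tsupport_fderiv_apply_subset ℝ _

theorem partialDeriv_sum_smul {d : ℕ} {ι : Type*} [Fintype ι] (a : ι → ℝ)
    {f : ι → EuclideanSpace ℝ (Fin d) → ℝ} (hf : ∀ m, ContDiff ℝ ∞ (f m)) (i : Fin d) :
    partialDeriv i (fun x => ∑ m, a m * f m x) = fun x => ∑ m, a m * partialDeriv i (f m) x := by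
  funext x
  have h : ∀ m, DifferentiableAt ℝ (f m) x := fun m => (hf m).contDiffAt.differentiableAt (by simp)
  simp only [partialDeriv]
  rw [fderiv_fun_sum fun m _ => (h m).const_mul (a m)]
  simp [fderiv_const_mul (h _)]

theorem mixedDeriv_sum_smul {d : ℕ} {ι : Type*} [Fintype ι] (a : ι → ℝ)
    {f : ι → EuclideanSpace ℝ (Fin d) → ℝ} (hf : ∀ m, ContDiff ℝ ∞ (f m)) (σ : Fin d → ℕ) :
    mixedDeriv σ (fun x => ∑ m, a m * f m x) = fun x => ∑ m, a m * mixedDeriv σ (f m) x := by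
  unfold mixedDeriv
  induction List.finRange d with
  | nil => rfl
  | cons i l ih =>
    simp only [List.foldr_cons]
    rw [ih]
    generalize σ i = n
    have hs : ∀ m, ContDiff ℝ ∞ (l.foldr (fun i g => (partialDeriv i)^[σ i] g) (f m)) := fun m =>
      foldr_iterate_induction (ContDiff ℝ ∞) partialDeriv σ (fun i _ h => h.partialDeriv i) (hf m) l
    induction n with
    | zero => rfl
    | succ n ihn =>
      simp only [Function.iterate_succ_apply']
      rw [ihn, partialDeriv_sum_smul a]
      exact fun m => Function.Iterate.rec (ContDiff ℝ ∞) (hs m) (fun g hg => hg.partialDeriv i) n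

theorem partialDeriv_const_mul {d : ℕ} (c : ℝ) {f : EuclideanSpace ℝ (Fin d) → ℝ}
    (hf : ContDiff ℝ ∞ f) (i : Fin d) :
    partialDeriv i (fun x => c * f x) = fun x => c * partialDeriv i f x := by
  simpa using partialDeriv_sum_smul (fun _ : Unit => c) (f := fun _ => f) (fun _ => hf) i

theorem partialDeriv_comp_rescale {d : ℕ} (c : ℝ) (x₀ : EuclideanSpace ℝ (Fin d))
    {f : EuclideanSpace ℝ (Fin d) → ℝ} (hf : ContDiff ℝ ∞ f) (i : Fin d) :
    partialDeriv i (fun x => f (c • (x - x₀))) = fun x => c * partialDeriv i f (c • (x - x₀)) := by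
  funext x
  have h : HasFDerivAt f (fderiv ℝ f (c • (x - x₀))) (c • (x - x₀)) :=
    (hf.contDiffAt.differentiableAt (by simp)).hasFDerivAt
  have h2 := h.comp x (((hasFDerivAt_id x).sub_const x₀).const_smul c)
  simp only [partialDeriv]
  have : fderiv ℝ (fun x => f (c • (x - x₀))) x = _ := h2.fderiv
  rw [this]
  simp

theorem mixedDeriv_comp_rescale {d : ℕ} (c : ℝ) (x₀ : EuclideanSpace ℝ (Fin d))
    {f : EuclideanSpace ℝ (Fin d) → ℝ} (hf : ContDiff ℝ ∞ f) (σ : Fin d → ℕ) :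
    mixedDeriv σ (fun x => f (c • (x - x₀))) =
      fun x => c ^ (∑ i, σ i) * mixedDeriv σ f (c • (x - x₀)) := by
  rw [Fin.sum_univ_def]
  unfold mixedDeriv
  induction List.finRange d with
  | nil => simp
  | cons i l ih =>
    simp only [List.foldr_cons, List.map_cons, List.sum_cons]
    rw [ih]
    generalize σ i = n
    have hs : ContDiff ℝ ∞ (l.foldr (fun i g => (partialDeriv i)^[σ i] g) f) :=
      foldr_iterate_induction (ContDiff ℝ ∞) partialDeriv σ (fun i _ h => h.partialDeriv i) hf l
    induction n with
    | zero => simp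
    | succ n ihn =>
      have hn := Function.Iterate.rec (ContDiff ℝ ∞) hs (fun g hg => hg.partialDeriv i) n
      simp only [Function.iterate_succ_apply']
      rw [ihn, partialDeriv_const_mul, partialDeriv_comp_rescale c x₀ hn]
      · funext x; ring
      · exact hn.comp (by fun_prop)

theorem mixedDeriv_single {d : ℕ} (i : Fin d) (f : EuclideanSpace ℝ (Fin d) → ℝ) :
    mixedDeriv (Pi.single i 1) f = partialDeriv i f := by
  have key : ∀ l : List (Fin d), l.Nodup →
      l.foldr (fun j g => (partialDeriv j)^[(Pi.single i 1 : Fin d → ℕ) j] g) f =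
        if i ∈ l then partialDeriv i f else f := by
    intro l hl
    induction l with
    | nil => simp
    | cons j l ih =>
      rw [List.nodup_cons] at hl
      rw [List.foldr_cons, ih hl.2]
      by_cases hj : j = i
      · subst hj
        simp [hl.1]
      · simp [hj, Ne.symm hj]
  exact (key _ (List.nodup_finRange d)).trans (by simp)

theorem sum_multiIndices_one {d : ℕ} (F : (Fin d → ℕ) → ℝ) :
    ∑ σ ∈ multiIndices d 1, F σ = ∑ i, F (Pi.single i 1) := by
  symm
  refine Finset.sum_bij (fun i _ => Pi.single i 1) (fun i _ => ?_) (fun i _ j _ hij => ?_)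
    (fun σ hσ => ?_) (fun _ _ => rfl)
  · rw [mem_multiIndices]; simp
  · by_contra h
    have := congrFun hij i
    simp [h] at this
  · rw [mem_multiIndices] at hσ
    obtain ⟨i, hi⟩ : ∃ i, σ i ≠ 0 := by
      by_contra! h
      simp [h] at hσ
    refine ⟨i, Finset.mem_univ _, ?_⟩
    have h1 := Finset.add_sum_erase Finset.univ σ (Finset.mem_univ i)
    rw [hσ] at h1
    have h2 : ∑ j ∈ Finset.univ.erase i, σ j = 0 := by omega
    funext j
    by_cases hj : j = i
    · subst hj; simp; omega
    · have := Finset.sum_eq_zero_iff.1 h2 j (by simp [hj])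
      simp [hj, this]

/-! ### Testing the weak equation -/

/-- The Cauchy–Schwarz inequality for finite families of square integrable functions. -/
theorem abs_sum_integral_mul_le_sqrt_mul_sqrt {α ι : Type*} [MeasurableSpace α] {μ : Measure α}
    (s : Finset ι) {w v : ι → α → ℝ} (hw : ∀ i ∈ s, MemLp (w i) 2 μ)
    (hv : ∀ i ∈ s, MemLp (v i) 2 μ) :
    |∑ i ∈ s, ∫ x, w i x * v i x ∂μ| ≤
      √(∑ i ∈ s, ∫ x, w i x ^ 2 ∂μ) * √(∑ i ∈ s, ∫ x, v i x ^ 2 ∂μ) := by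
  set A := ∑ i ∈ s, ∫ x, w i x ^ 2 ∂μ with hA
  set B := ∑ i ∈ s, ∫ x, w i x * v i x ∂μ with hB
  set D := ∑ i ∈ s, ∫ x, v i x ^ 2 ∂μ with hD
  have hA0 : 0 ≤ A := Finset.sum_nonneg fun i _ => integral_nonneg fun x => sq_nonneg _
  -- The quadratic polynomial `∑ ∫ (w - t v) ^ 2` in `t` is nonnegative, so its discriminant is not
  -- positive.
  have key : ∀ t : ℝ, 0 ≤ D * (t * t) + (-2 * B) * t + A := by
    intro t
    have h0 : 0 ≤ ∑ i ∈ s, ∫ x, (w i x - t * v i x) ^ 2 ∂μ :=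
      Finset.sum_nonneg fun i _ => integral_nonneg fun x => sq_nonneg _
    refine h0.trans_eq ?_
    rw [hA, hB, hD, Finset.sum_mul, Finset.mul_sum, Finset.sum_mul, ← Finset.sum_add_distrib,
      ← Finset.sum_add_distrib]
    refine Finset.sum_congr rfl fun i hi => ?_
    have i1 := (hw i hi).integrable_sq
    have i2 : Integrable (fun x => w i x * v i x) μ := (hw i hi).integrable_mul (hv i hi)
    have i3 := (hv i hi).integrable_sq
    have e : ∀ x, (w i x - t * v i x) ^ 2 =
        (t * t) * v i x ^ 2 + (-2 * t) * (w i x * v i x) + w i x ^ 2 := fun x => by ring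
    simp_rw [e]
    have i4 : Integrable (fun x => (t * t) * v i x ^ 2 + (-2 * t) * (w i x * v i x)) μ :=
      (i3.const_mul _).add (i2.const_mul _)
    rw [integral_add i4 i1,
      integral_add (i3.const_mul _) (i2.const_mul _), integral_const_mul, integral_const_mul]
    ring
  have hd := discrim_le_zero key
  rw [discrim] at hd
  rw [← Real.sqrt_mul hA0]
  exact Real.abs_le_sqrt (by linarith)

theorem MemSobolevZero.memLp_weakDeriv {d k : ℕ} {Ω : Set (EuclideanSpace ℝ (Fin d))}
    (hΩ : IsOpen Ω) {u : EuclideanSpace ℝ (Fin d) → ℝ} (hu : MemSobolevZero Ω k u)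
    {σ : Fin d → ℕ} (hσ : ∑ i, σ i ≤ k) : MemLp (weakDeriv Ω σ u) 2 (volume.restrict Ω) := by
  obtain ⟨g, hg, hm⟩ := hu.1.2 σ hσ
  exact hm.ae_eq (hg.ae_unique hΩ hg.weakDeriv_spec)

/-- The seminorm of `φ` is taken over the whole space, so that it can be rescaled without reference
to `Ω`. -/
theorem IsDirichletSolution.abs_integral_mul_le {d k : ℕ} {Ω : Set (EuclideanSpace ℝ (Fin d))}
    (hΩ : IsOpen Ω) {u f : EuclideanSpace ℝ (Fin d) → ℝ} (hu : IsDirichletSolution Ω k u f)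
    {φ : EuclideanSpace ℝ (Fin d) → ℝ} (hφ : IsTestFunction Ω φ) :
    |∫ x in Ω, f x * φ x| ≤
      sobolevSeminorm Ω k u * √(∑ σ ∈ multiIndices d k, ∫ x, mixedDeriv σ φ x ^ 2) := by
  have hL : ∀ σ, MemLp (mixedDeriv σ φ) 2 (volume : Measure (EuclideanSpace ℝ (Fin d))) := fun σ =>
    (hφ.1.mixedDeriv σ).continuous.memLp_of_hasCompactSupport (hφ.2.1.mixedDeriv σ)
  rw [← hu.2 φ hφ]
  refine (abs_sum_integral_mul_le_sqrt_mul_sqrt _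
    (fun σ hσ => hu.1.memLp_weakDeriv hΩ (mem_multiIndices.1 hσ).le)
    (fun σ _ => (hL σ).restrict Ω)).trans ?_
  refine mul_le_mul_of_nonneg_left (Real.sqrt_le_sqrt (Finset.sum_le_sum fun σ _ => ?_))
    (Real.sqrt_nonneg _)
  exact setIntegral_le_integral (hL σ).integrable_sq (ae_of_all _ fun x => sq_nonneg _)

/-! ### Polynomials as a finite-dimensional space -/

/-- `G / E` is continuous on the compact unit sphere, hence bounded there; homogeneity extends the
bound to all vectors. -/
theorem exists_forall_le_mul_of_homogeneous {ι : Type*} [Fintype ι] {E G : (ι → ℝ) → ℝ}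
    (hE : Continuous E) (hG : Continuous G) (hE2 : ∀ (c : ℝ) a, E (c • a) = c ^ 2 * E a)
    (hG2 : ∀ (c : ℝ) a, G (c • a) = c ^ 2 * G a) (hpos : ∀ a, a ≠ 0 → 0 < E a) :
    ∃ K, 0 < K ∧ ∀ a, G a ≤ K * E a := by
  have hc : ContinuousOn (fun a => G a / E a) (Metric.sphere 0 1) :=
    hG.continuousOn.div hE.continuousOn fun a ha =>
      (hpos a (ne_zero_of_mem_unit_sphere ⟨a, ha⟩)).ne'
  obtain ⟨K, hK⟩ := (isCompact_sphere (0 : ι → ℝ) 1).bddAbove_image hc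
  -- The bound `K` may be nonpositive, for instance when the sphere is empty.
  refine ⟨max K 1, by positivity, fun a => ?_⟩
  rcases eq_or_ne a 0 with rfl | ha
  · have h1 := hE2 0 0
    have h2 := hG2 0 0
    simp only [smul_zero, ne_eq, OfNat.ofNat_ne_zero, not_false_eq_true, zero_pow, zero_mul]
      at h1 h2
    rw [h1, h2, mul_zero]
  · have hn : ‖a‖ ≠ 0 := norm_ne_zero_iff.2 ha
    have hb : ‖a‖⁻¹ • a ∈ Metric.sphere (0 : ι → ℝ) 1 := by
      rw [mem_sphere_zero_iff_norm, norm_smul, norm_inv, norm_norm, inv_mul_cancel₀ hn]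
    have h1 := hK ⟨_, hb, rfl⟩
    simp only [hE2, hG2] at h1
    rw [mul_div_mul_left _ _ (by positivity), div_le_iff₀ (hpos a ha)] at h1
    exact h1.trans (mul_le_mul_of_nonneg_right (le_max_left _ _) (hpos a ha).le)

theorem continuous_integral_sq_sum {α ι : Type*} [Fintype ι] [MeasurableSpace α] {μ : Measure α}
    {g : ι → α → ℝ} (hg : ∀ m n, Integrable (fun x => g m x * g n x) μ) :
    Continuous fun a : ι → ℝ => ∫ x, (∑ m, a m * g m x) ^ 2 ∂μ := by
  have : (fun a : ι → ℝ => ∫ x, (∑ m, a m * g m x) ^ 2 ∂μ) =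
      fun a => ∑ m, ∑ n, a m * a n * ∫ x, g m x * g n x ∂μ := by
    funext a
    have e : ∀ x, (∑ m, a m * g m x) ^ 2 = ∑ m, ∑ n, a m * a n * (g m x * g n x) := fun x => by
      rw [sq, Finset.sum_mul_sum]
      exact Finset.sum_congr rfl fun m _ => Finset.sum_congr rfl fun n _ => by ring
    simp_rw [e]
    rw [integral_finsetSum _ fun m _ => integrable_finsetSum _ fun n _ => (hg m n).const_mul _]
    refine Finset.sum_congr rfl fun m _ => ?_
    rw [integral_finsetSum _ fun n _ => (hg m n).const_mul _]
    exact Finset.sum_congr rfl fun n _ => integral_const_mul _ _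
  rw [this]
  fun_prop

theorem integral_sq_sum_smul {α ι : Type*} [Fintype ι] [MeasurableSpace α] {μ : Measure α}
    (g : ι → α → ℝ) (c : ℝ) (a : ι → ℝ) :
    ∫ x, (∑ m, (c • a) m * g m x) ^ 2 ∂μ = c ^ 2 * ∫ x, (∑ m, a m * g m x) ^ 2 ∂μ := by
  rw [← integral_const_mul]
  congr 1
  funext x
  rw [← mul_pow, Finset.mul_sum]
  simp only [Pi.smul_apply, smul_eq_mul, mul_assoc]

/-- The polynomial function on `ℝ^d` of degree less than `s` in each variable, with
coefficients `a`. -/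
noncomputable def polyFun {d s : ℕ} (a : (Fin d → Fin s) → ℝ) (x : EuclideanSpace ℝ (Fin d)) : ℝ :=
  ∑ m, a m * ∏ i, x i ^ (m i : ℕ)

theorem contDiff_prod_pow {d : ℕ} (m : Fin d → ℕ) :
    ContDiff ℝ ∞ fun x : EuclideanSpace ℝ (Fin d) => ∏ i, x i ^ m i :=
  contDiff_prod fun i _ => ContDiff.pow (by fun_prop) _

theorem contDiff_polyFun {d s : ℕ} (a : (Fin d → Fin s) → ℝ) : ContDiff ℝ ∞ (polyFun a) :=
  ContDiff.sum fun m _ => contDiff_const.mul (contDiff_prod_pow fun i => (m i : ℕ))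

/-- Total degree below `s` forces every exponent below `s`. The larger space of `polyFun` does no
harm: only its finite dimension matters. -/
theorem exists_eval_eq_polyFun {d s : ℕ} {q : MvPolynomial (Fin d) ℝ} (hq : q.totalDegree < s) :
    ∃ a : (Fin d → Fin s) → ℝ, ∀ x : EuclideanSpace ℝ (Fin d),
      MvPolynomial.eval (fun i => x i) q = polyFun a x := by
  let e : (Fin d → Fin s) → (Fin d →₀ ℕ) := fun m =>
    Finsupp.equivFunOnFinite.symm fun i => (m i : ℕ)
  have he : Function.Injective e := fun m n h => by
    funext i
    exact Fin.ext (DFunLike.congr_fun h i)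
  refine ⟨fun m => q.coeff (e m), fun x => ?_⟩
  rw [MvPolynomial.eval_eq', polyFun]
  refine Eq.trans ?_ (Finset.sum_image (s := Finset.univ) (g := e)
    (f := fun m => q.coeff m * ∏ i, x i ^ m i) (fun m _ n _ h => he h))
  refine Finset.sum_subset (fun m hm => ?_) fun m _ hm => ?_
  · have hb : ∀ i, m i < s := fun i => by
      refine lt_of_le_of_lt ?_ ((MvPolynomial.le_totalDegree hm).trans_lt hq)
      rw [Finsupp.sum_fintype _ _ (fun _ => rfl)]
      exact Finset.single_le_sum (fun _ _ => Nat.zero_le _) (Finset.mem_univ i)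
    exact Finset.mem_image.2 ⟨fun i => ⟨m i, hb i⟩, Finset.mem_univ _, Finsupp.ext fun i => rfl⟩
  · rw [MvPolynomial.notMem_support_iff.1 hm, zero_mul]

/-- The ball contains a cube, and a polynomial vanishing on a product of infinite sets is zero. -/
theorem eq_zero_of_polyFun_eqOn_ball {d s : ℕ} {a : (Fin d → Fin s) → ℝ} {r : ℝ} (hr : 0 < r)
    (h : ∀ x ∈ Metric.ball (0 : EuclideanSpace ℝ (Fin d)) r, polyFun a x = 0) : a = 0 := by
  let e : (Fin d → Fin s) → (Fin d →₀ ℕ) := fun m =>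
    Finsupp.equivFunOnFinite.symm fun i => (m i : ℕ)
  have he : Function.Injective e := fun m n h => by
    funext i
    exact Fin.ext (DFunLike.congr_fun h i)
  let q : MvPolynomial (Fin d) ℝ := ∑ m, MvPolynomial.monomial (e m) (a m)
  have hq : ∀ x : Fin d → ℝ, MvPolynomial.eval x q = polyFun a (WithLp.toLp 2 x) := fun x => by
    simp only [q, polyFun, map_sum, MvPolynomial.eval_monomial]
    refine Finset.sum_congr rfl fun m _ => ?_
    rw [Finsupp.prod_fintype _ _ (fun _ => pow_zero _)]
    rfl
  have ho : IsOpen ((WithLp.toLp 2 : (Fin d → ℝ) → EuclideanSpace ℝ (Fin d)) ⁻¹'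
      Metric.ball 0 r) := Metric.isOpen_ball.preimage (PiLp.continuous_toLp 2 _)
  obtain ⟨ρ, hρ, hsub⟩ := Metric.isOpen_iff.1 ho 0 (by simpa using hr)
  have hq0 : q = 0 := by
    refine MvPolynomial.funext_set (fun _ => Metric.ball (0 : ℝ) ρ) (fun _ => ?_) fun x hx => ?_
    · rw [Real.ball_eq_Ioo]
      exact Set.Ioo_infinite (by linarith)
    · rw [map_zero, hq]
      refine h _ (hsub ?_)
      rw [mem_ball_zero_iff, pi_norm_lt_iff hρ]
      exact fun i => mem_ball_zero_iff.1 (hx i (Set.mem_univ i))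
  funext m
  have := congrArg (MvPolynomial.coeff (e m)) hq0
  simpa [q, MvPolynomial.coeff_sum, MvPolynomial.coeff_monomial, he.eq_iff] using this

theorem totalDegree_aeval_affine_le {d : ℕ} (p : MvPolynomial (Fin d) ℝ) (x₀ : Fin d → ℝ) (h : ℝ) :
    (MvPolynomial.aeval (fun i => MvPolynomial.C (x₀ i) + MvPolynomial.C h * MvPolynomial.X i :
      Fin d → MvPolynomial (Fin d) ℝ) p).totalDegree ≤ p.totalDegree := by
  have h1 : ∀ i, (MvPolynomial.C (x₀ i) + MvPolynomial.C h * MvPolynomial.X i :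
      MvPolynomial (Fin d) ℝ).totalDegree ≤ 1 := fun i => by
    refine (MvPolynomial.totalDegree_add _ _).trans (max_le (by simp) ?_)
    refine (MvPolynomial.totalDegree_mul _ _).trans ?_
    simp
  rw [MvPolynomial.aeval_def, MvPolynomial.eval₂_eq]
  refine MvPolynomial.totalDegree_finsetSum_le fun m hm => ?_
  refine (MvPolynomial.totalDegree_mul _ _).trans ?_
  rw [MvPolynomial.algebraMap_eq, MvPolynomial.totalDegree_C, zero_add]
  refine (MvPolynomial.totalDegree_finsetProd _ _).trans
    (le_trans (Finset.sum_le_sum fun i _ => ?_) (MvPolynomial.le_totalDegree hm))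
  refine (MvPolynomial.totalDegree_pow _ _).trans ?_
  simpa using Nat.mul_le_mul_left (m i) (h1 i)

/-- An affine substitution does not raise the degree, so one reference space serves all `x₀` and
`h`. -/
theorem exists_eval_eq_polyFun_rescale {d s : ℕ} {p : MvPolynomial (Fin d) ℝ}
    (hp : p.totalDegree < s) (x₀ : EuclideanSpace ℝ (Fin d)) {h : ℝ} (hh : h ≠ 0) :
    ∃ a : (Fin d → Fin s) → ℝ, ∀ x : EuclideanSpace ℝ (Fin d),
      MvPolynomial.eval (fun i => x i) p = polyFun a (h⁻¹ • (x - x₀)) := by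
  obtain ⟨a, ha⟩ := exists_eval_eq_polyFun
    ((totalDegree_aeval_affine_le p (fun i => x₀ i) h).trans_lt hp)
  refine ⟨a, fun x => ?_⟩
  rw [← ha, MvPolynomial.aeval_def, MvPolynomial.eval_eval₂, MvPolynomial.algebraMap_eq]
  have : (MvPolynomial.eval fun i => (h⁻¹ • (x - x₀)) i).comp MvPolynomial.C =
      RingHom.id ℝ := by ext; simp
  rw [this, ← MvPolynomial.eval₂_id]
  congr 1
  funext i
  simp [hh]

theorem Continuous.integrableOn_of_isBounded {X : Type*} [PseudoMetricSpace X] [ProperSpace X]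
    [MeasurableSpace X] [OpensMeasurableSpace X] {μ : Measure X} [IsFiniteMeasureOnCompacts μ]
    {f : X → ℝ} (hf : Continuous f) {S : Set X} (hS : Bornology.IsBounded S) :
    IntegrableOn f S μ :=
  (hf.continuousOn.integrableOn_compact' hS.isCompact_closure
    isClosed_closure.measurableSet).mono_set subset_closure

theorem integral_ball_polyFun_sq_pos {d s : ℕ} {r : ℝ} (hr : 0 < r) {a : (Fin d → Fin s) → ℝ}
    (ha : a ≠ 0) :
    0 < ∫ x in Metric.ball (0 : EuclideanSpace ℝ (Fin d)) r, polyFun a x ^ 2 := by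
  have hc : Continuous fun x : EuclideanSpace ℝ (Fin d) => polyFun a x ^ 2 :=
    (contDiff_polyFun a).continuous.pow 2
  have h0 : 0 ≤ ∫ x in Metric.ball (0 : EuclideanSpace ℝ (Fin d)) r, polyFun a x ^ 2 :=
    integral_nonneg fun x => sq_nonneg _
  refine h0.lt_of_ne fun h => ha (eq_zero_of_polyFun_eqOn_ball hr fun x hx => ?_)
  have hi : IntegrableOn (fun x : EuclideanSpace ℝ (Fin d) => polyFun a x ^ 2)
      (Metric.ball 0 r) := (hc.integrableOn_of_isBounded Metric.isBounded_ball)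
  have hae := (integral_eq_zero_iff_of_nonneg (fun x => sq_nonneg _) hi).1 h.symm
  have := Measure.eqOn_open_of_ae_eq hae Metric.isOpen_ball hc.continuousOn continuousOn_const hx
  exact pow_eq_zero_iff two_ne_zero |>.1 this

/-- On polynomials of bounded degree, the norms on the unit ball and the seminorms of a cut-off
are controlled by the norm weighted with the cut-off function. -/
theorem exists_cutoff_bound (k s d : ℕ) {δ : ℝ} (hδ : 0 < δ) :
    ∃ η : EuclideanSpace ℝ (Fin d) → ℝ, ∃ K : ℝ, IsTestFunction (Metric.ball 0 (δ / 2)) η ∧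
      0 < K ∧ ∀ a : (Fin d → Fin s) → ℝ,
        (∑ σ ∈ multiIndices d k, ∫ x, mixedDeriv σ (fun x => η x * polyFun a x) x ^ 2) ≤
          K * ∫ x, η x * polyFun a x ^ 2 ∧
        ∫ x in Metric.closedBall 0 1, polyFun a x ^ 2 ≤ K * ∫ x, η x * polyFun a x ^ 2 := by
  -- The bump is `1` on the ball of radius `δ / 8`, and its support stays strictly inside the ball
  -- of radius `δ / 2`.
  let b : ContDiffBump (0 : EuclideanSpace ℝ (Fin d)) := ⟨δ / 8, δ / 4, by positivity, by linarith⟩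
  have hb : IsTestFunction (Metric.ball 0 (δ / 2)) b := by
    refine ⟨b.contDiff, b.hasCompactSupport, ?_⟩
    rw [b.tsupport_eq]
    exact Metric.closedBall_subset_ball (by change δ / 4 < δ / 2; linarith)
  let g : (Fin d → Fin s) → EuclideanSpace ℝ (Fin d) → ℝ := fun m x => ∏ i, x i ^ (m i : ℕ)
  have hg : ∀ m, ContDiff ℝ ∞ (g m) := fun m => contDiff_prod_pow fun i => (m i : ℕ)
  have hgint : ∀ (S : Set (EuclideanSpace ℝ (Fin d))), Bornology.IsBounded S → ∀ m n,
      Integrable (fun x => g m x * g n x) (volume.restrict S) := fun S hS m n =>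
    ((hg m).continuous.mul (hg n).continuous).integrableOn_of_isBounded hS
  have hbg : ∀ m, ContDiff ℝ ∞ fun x => b x * g m x := fun m => b.contDiff.mul (hg m)
  have hD : ∀ (σ : Fin d → ℕ) (a : (Fin d → Fin s) → ℝ),
      mixedDeriv σ (fun x => b x * polyFun a x) =
        fun x => ∑ m, a m * mixedDeriv σ (fun x => b x * g m x) x := fun σ a => by
    rw [← mixedDeriv_sum_smul a hbg]
    congr 1
    funext x
    rw [polyFun, Finset.mul_sum]
    exact Finset.sum_congr rfl fun m _ => mul_left_comm _ _ _
  have hDint : ∀ (σ : Fin d → ℕ) m n, Integrable (fun x =>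
      mixedDeriv σ (fun x => b x * g m x) x * mixedDeriv σ (fun x => b x * g n x) x) :=
    fun σ m n => (((hbg m).mixedDeriv σ).continuous.mul
      ((hbg n).mixedDeriv σ).continuous).integrable_of_hasCompactSupport
        (((b.hasCompactSupport.mul_right).mixedDeriv σ).mul_right)
  have hE := continuous_integral_sq_sum (hgint (Metric.ball 0 (δ / 8)) Metric.isBounded_ball)
  -- Adding the two quantities to be bounded gives a single `K` for both. They are compared with the
  -- integral over the small ball where `b = 1`, which is positive definite in the coefficients.
  have hG : Continuous fun a : (Fin d → Fin s) → ℝ =>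
      (∑ σ ∈ multiIndices d k, ∫ x, (∑ m, a m * mixedDeriv σ (fun x => b x * g m x) x) ^ 2) +
        ∫ x in Metric.closedBall 0 1, (∑ m, a m * g m x) ^ 2 :=
    (continuous_finsetSum _ fun σ _ => continuous_integral_sq_sum (hDint σ)).add
      (continuous_integral_sq_sum (hgint (Metric.closedBall 0 1) Metric.isBounded_closedBall))
  obtain ⟨K, hK, h⟩ := exists_forall_le_mul_of_homogeneous hE hG (integral_sq_sum_smul g)
    (fun c a => by
      simp only [integral_sq_sum_smul]
      rw [mul_add, Finset.mul_sum])
    (fun a ha => integral_ball_polyFun_sq_pos (by positivity) ha)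
  refine ⟨b, K, hb, hK, fun a => ?_⟩
  have hQ : Continuous fun x : EuclideanSpace ℝ (Fin d) => polyFun a x ^ 2 :=
    (contDiff_polyFun a).continuous.pow 2
  have hle : ∫ x in Metric.ball 0 (δ / 8), (∑ m, a m * g m x) ^ 2 ≤ ∫ x, b x * polyFun a x ^ 2 := by
    have hi : Integrable (fun x => b x * polyFun a x ^ 2) :=
      (b.continuous.mul hQ).integrable_of_hasCompactSupport b.hasCompactSupport.mul_right
    refine le_trans (le_of_eq ?_) (setIntegral_le_integral (s := Metric.ball 0 (δ / 8)) hi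
      (ae_of_all _ fun x => mul_nonneg b.nonneg (sq_nonneg _)))
    refine setIntegral_congr_fun Metric.isOpen_ball.measurableSet fun x hx => ?_
    have : b x = 1 := b.one_of_mem_closedBall (Metric.ball_subset_closedBall hx)
    simp only [this, one_mul]
    rfl
  have h1 := (h a).trans (mul_le_mul_of_nonneg_left hle hK.le)
  have h2 : 0 ≤ ∑ σ ∈ multiIndices d k,
      ∫ x, (∑ m, a m * mixedDeriv σ (fun x => b x * g m x) x) ^ 2 :=
    Finset.sum_nonneg fun σ _ => integral_nonneg fun x => sq_nonneg _
  have h3 : 0 ≤ ∫ x in Metric.closedBall 0 1, (∑ m, a m * g m x) ^ 2 :=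
    integral_nonneg fun x => sq_nonneg _
  refine ⟨?_, ?_⟩
  · simp_rw [hD]
    linarith
  · change ∫ x in Metric.closedBall 0 1, (∑ m, a m * g m x) ^ 2 ≤ _
    linarith

/-! ### Rescaling and the general estimate -/

theorem integral_comp_rescale {d : ℕ} {h : ℝ} (hh : 0 < h) (x₀ : EuclideanSpace ℝ (Fin d))
    (f : EuclideanSpace ℝ (Fin d) → ℝ) :
    ∫ x, f (h⁻¹ • (x - x₀)) = h ^ d * ∫ x, f x := by
  rw [integral_sub_right_eq_self (fun x => f (h⁻¹ • x)), Measure.integral_comp_smul,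
    finrank_euclideanSpace_fin, inv_pow, inv_inv, abs_of_pos (by positivity), smul_eq_mul]

theorem IsTestFunction.comp_rescale {d : ℕ} {h r : ℝ} (hh : 0 < h)
    {x₀ : EuclideanSpace ℝ (Fin d)} {Ω : Set (EuclideanSpace ℝ (Fin d))}
    (hΩ : Metric.ball x₀ (r * h) ⊆ Ω) {η : EuclideanSpace ℝ (Fin d) → ℝ}
    (hη : IsTestFunction (Metric.ball 0 r) η) :
    IsTestFunction Ω fun x => η (h⁻¹ • (x - x₀)) := by
  let e : EuclideanSpace ℝ (Fin d) ≃ₜ EuclideanSpace ℝ (Fin d) :=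
    (Homeomorph.subRight x₀).trans (Homeomorph.smulOfNeZero h⁻¹ (inv_ne_zero hh.ne'))
  refine ⟨hη.1.comp (by fun_prop), hη.2.1.comp_homeomorph e, ?_⟩
  have h1 : tsupport (η ∘ e) = e ⁻¹' tsupport η := tsupport_comp_eq_preimage η e
  refine (h1.subset.trans (Set.preimage_mono hη.2.2)).trans fun x hx => hΩ ?_
  have hx' : h⁻¹ • (x - x₀) ∈ Metric.ball 0 r := hx
  rw [mem_ball_zero_iff, norm_smul, Real.norm_of_nonneg (by positivity), inv_mul_lt_iff₀ hh] at hx'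
  rw [Metric.mem_ball, dist_eq_norm, mul_comm]
  exact hx'

/-- The constant is `K` itself: one factor `K` comes from the seminorm of the test function and one
from the unit ball norm, and the final estimate is between squares. -/
theorem exists_l2Norm_le_mul_sobolevSeminorm (k s d : ℕ) {δ : ℝ} (hδ : 0 < δ) :
    ∃ C : ℝ, 0 < C ∧ ∀ h : ℝ, 0 < h →
      ∀ Ω : Set (EuclideanSpace ℝ (Fin d)), IsOpen Ω → Bornology.IsBounded Ω →
        Metric.diam Ω ≤ h →
        ∀ x₀ : EuclideanSpace ℝ (Fin d), Metric.ball x₀ (δ * h / 2) ⊆ Ω →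
          ∀ p : MvPolynomial (Fin d) ℝ, p.totalDegree < s →
            ∀ u : EuclideanSpace ℝ (Fin d) → ℝ,
              IsDirichletSolution Ω k u (fun x => MvPolynomial.eval (fun i => x i) p) →
              l2Norm Ω (fun x => MvPolynomial.eval (fun i => x i) p) ≤
                C * (h ^ k)⁻¹ * sobolevSeminorm Ω k u := by
  obtain ⟨η, K, hη, hK, hbound⟩ := exists_cutoff_bound k s d hδ
  refine ⟨K, hK, fun h hh Ω hΩ hbdd hdiam x₀ hball p hp u hu => ?_⟩
  obtain ⟨a, ha⟩ := exists_eval_eq_polyFun_rescale hp x₀ hh.ne'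
  simp_rw [ha] at hu ⊢
  obtain ⟨hF, hA⟩ := hbound a
  set F := ∑ σ ∈ multiIndices d k, ∫ x, mixedDeriv σ (fun x => η x * polyFun a x) x ^ 2 with hFdef
  set E := ∫ x, η x * polyFun a x ^ 2 with hEdef
  set A := ∫ x in Metric.closedBall 0 1, polyFun a x ^ 2 with hAdef
  set U := sobolevSeminorm Ω k u with hUdef
  have hU : 0 ≤ U := Real.sqrt_nonneg _
  have hF0 : 0 ≤ F := Finset.sum_nonneg fun σ _ => integral_nonneg fun x => sq_nonneg _
  have hE0 : 0 ≤ E := nonneg_of_mul_nonneg_right (hF0.trans hF) hK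
  have hηp : IsTestFunction (Metric.ball 0 (δ / 2)) fun x => η x * polyFun a x :=
    ⟨hη.1.mul (contDiff_polyFun a), hη.2.1.mul_right, tsupport_mul_subset_left.trans hη.2.2⟩
  have hφ : IsTestFunction Ω fun x => η (h⁻¹ • (x - x₀)) * polyFun a (h⁻¹ • (x - x₀)) :=
    hηp.comp_rescale hh (by rwa [div_mul_eq_mul_div])
  have htest := (le_abs_self _).trans (hu.abs_integral_mul_le hΩ hφ)
  have hL : ∫ x in Ω, polyFun a (h⁻¹ • (x - x₀)) *
      (η (h⁻¹ • (x - x₀)) * polyFun a (h⁻¹ • (x - x₀))) = h ^ d * E := by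
    rw [setIntegral_eq_integral_of_forall_compl_eq_zero, hEdef, ← integral_comp_rescale hh x₀]
    · exact integral_congr_ae (ae_of_all _ fun x => by ring)
    · intro x hx
      have h0 : η (h⁻¹ • (x - x₀)) * polyFun a (h⁻¹ • (x - x₀)) = 0 :=
        image_eq_zero_of_notMem_tsupport (f := fun x => η (h⁻¹ • (x - x₀)) *
          polyFun a (h⁻¹ • (x - x₀))) fun h' => hx (hφ.2.2 h')
      rw [h0, mul_zero]
  have hR : ∑ σ ∈ multiIndices d k, ∫ x, mixedDeriv σ
      (fun x => η (h⁻¹ • (x - x₀)) * polyFun a (h⁻¹ • (x - x₀))) x ^ 2 =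
        (h ^ k)⁻¹ ^ 2 * h ^ d * F := by
    rw [hFdef, Finset.mul_sum]
    refine Finset.sum_congr rfl fun σ hσ => ?_
    rw [mixedDeriv_comp_rescale h⁻¹ x₀ hηp.1, mem_multiIndices.1 hσ, mul_assoc,
      ← integral_comp_rescale hh x₀, ← integral_const_mul]
    simp_rw [mul_pow, inv_pow]
  rw [hL, hR] at htest
  have hd : 0 < h ^ d := by positivity
  have hN : ∫ x in Ω, polyFun a (h⁻¹ • (x - x₀)) ^ 2 ≤ h ^ d * A := by
    have hx₀ : x₀ ∈ Ω := hball (Metric.mem_ball_self (by positivity))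
    -- Since `x₀ ∈ Ω`, the diameter bound places the rescaled domain in the closed unit ball.
    have hsub : Ω ⊆ Metric.closedBall x₀ h := fun x hx =>
      (Metric.dist_le_diam_of_mem hbdd hx hx₀).trans hdiam
    have hc : Continuous fun x => polyFun a (h⁻¹ • (x - x₀)) ^ 2 :=
      ((contDiff_polyFun a).continuous.comp (by fun_prop)).pow 2
    refine (setIntegral_mono_set (hc.integrableOn_of_isBounded Metric.isBounded_closedBall)
      (ae_of_all _ fun x => sq_nonneg _) hsub.eventuallyLE).trans_eq ?_
    rw [hAdef, ← integral_indicator Metric.isClosed_closedBall.measurableSet,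
      ← integral_indicator Metric.isClosed_closedBall.measurableSet, ← integral_comp_rescale hh x₀]
    congr 1
    funext x
    simp only [Set.indicator, sub_zero, norm_smul, norm_inv,
      Real.norm_of_nonneg hh.le, Metric.mem_closedBall, dist_eq_norm, inv_mul_le_iff₀ hh, mul_one]
  have hk : 0 < (h ^ k)⁻¹ := by positivity
  rw [l2Norm]
  refine Real.sqrt_le_iff.2 ⟨by positivity, hN.trans ?_⟩
  have hsq : (h ^ d * E) ^ 2 ≤ U ^ 2 * ((h ^ k)⁻¹ ^ 2 * h ^ d * F) := by
    have := pow_le_pow_left₀ (by positivity) htest 2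
    rwa [mul_pow U, Real.sq_sqrt (by positivity)] at this
  have h1 : h ^ d * E ≤ K * U ^ 2 * (h ^ k)⁻¹ ^ 2 := by
    -- `E` enters squared on the left and once on the right; cancelling one factor needs `E ≠ 0`.
    rcases hE0.eq_or_lt with h0 | h0
    · rw [← h0, mul_zero]; positivity
    · have h2 : (h ^ d * E) * (h ^ d * E) ≤ (K * U ^ 2 * (h ^ k)⁻¹ ^ 2) * (h ^ d * E) := by
        calc (h ^ d * E) * (h ^ d * E) ≤ U ^ 2 * ((h ^ k)⁻¹ ^ 2 * h ^ d * F) := by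
              rw [← sq]; exact hsq
          _ ≤ U ^ 2 * ((h ^ k)⁻¹ ^ 2 * h ^ d * (K * E)) := by gcongr
          _ = _ := by ring
      exact le_of_mul_le_mul_right h2 (by positivity)
  calc h ^ d * A ≤ h ^ d * (K * E) := by gcongr
    _ = K * (h ^ d * E) := by ring
    _ ≤ K * (K * U ^ 2 * (h ^ k)⁻¹ ^ 2) := by gcongr
    _ = _ := by ring

/-! ### The explicit constant for `k = s = 1` -/

/-- A smooth minorant of the positive part, vanishing near `0`. -/
theorem exists_smooth_posPart {ε : ℝ} (hε : 0 < ε) :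
    ∃ g g' : ℝ → ℝ, ContDiff ℝ ∞ g ∧ (∀ t, HasDerivAt g (g' t) t) ∧ (∀ t, g' t ^ 2 ≤ 1) ∧
      (∀ t ≤ ε, g t = 0) ∧ ∀ t, t - 2 * ε ≤ g t := by
  -- `S` rises from `0` at `ε` to `1` at `2 * ε`, so its primitive loses at most `2 * ε` against
  -- `t`.
  let S : ℝ → ℝ := fun t => Real.smoothTransition ((t - ε) / ε)
  have hS : ContDiff ℝ ∞ S := Real.smoothTransition.contDiff.comp (by fun_prop)
  have hd : ∀ t, HasDerivAt (fun t => ∫ τ in (0 : ℝ)..t, S τ) (S t) t := fun t =>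
    hS.continuous.integral_hasStrictDerivAt 0 t |>.hasDerivAt
  have h0 : ∀ t ≤ ε, ∫ τ in (0 : ℝ)..t, S τ = 0 := fun t ht => by
    refine (intervalIntegral.integral_congr fun τ hτ => ?_).trans intervalIntegral.integral_zero
    have : τ ≤ ε := by
      rcases Set.mem_uIcc.1 hτ with h | h <;> linarith
    exact Real.smoothTransition.zero_of_nonpos (div_nonpos_of_nonpos_of_nonneg (by linarith) hε.le)
  refine ⟨fun t => ∫ τ in (0 : ℝ)..t, S τ, S, ?_, hd, fun t => ?_, h0, fun t => ?_⟩
  · refine contDiff_infty_iff_deriv.2 ⟨fun t => (hd t).differentiableAt, ?_⟩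
    rwa [show deriv (fun t => ∫ τ in (0 : ℝ)..t, S τ) = S from funext fun t => (hd t).deriv]
  · exact pow_le_one₀ (Real.smoothTransition.nonneg _) (Real.smoothTransition.le_one _)
  · change t - 2 * ε ≤ ∫ τ in (0 : ℝ)..t, S τ
    rcases le_total t (2 * ε) with ht | ht
    · rcases le_total t 0 with h | h
      · rw [h0 t (by linarith)]; linarith
      · have : 0 ≤ ∫ τ in (0 : ℝ)..t, S τ :=
          intervalIntegral.integral_nonneg h fun τ _ => Real.smoothTransition.nonneg _
        linarith
    · have h1 : 0 ≤ ∫ τ in (0 : ℝ)..(2 * ε), S τ :=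
        intervalIntegral.integral_nonneg (by linarith) fun τ _ => Real.smoothTransition.nonneg _
      have h2 : ∫ τ in (2 * ε)..t, S τ = t - 2 * ε := by
        rw [intervalIntegral.integral_congr (g := fun _ => (1 : ℝ))]
        · simp
        · intro τ hτ
          rw [Set.uIcc_of_le ht] at hτ
          exact Real.smoothTransition.one_of_one_le ((one_le_div hε).2 (by linarith [hτ.1]))
      rw [← intervalIntegral.integral_add_adjacent_intervals
        (hS.continuous.intervalIntegrable 0 (2 * ε)) (hS.continuous.intervalIntegrable (2 * ε) t)]
      linarith

theorem setIntegral_ball_dist_sq {d : ℕ} (hd : 1 ≤ d) (x₀ : EuclideanSpace ℝ (Fin d)) {r : ℝ}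
    (hr : 0 < r) :
    ∫ x in Metric.ball x₀ r, ‖x - x₀‖ ^ 2 =
      volume.real (Metric.ball (0 : EuclideanSpace ℝ (Fin d)) 1) * (d / (d + 2)) * r ^ (d + 2) := by
  have : Nonempty (Fin d) := ⟨⟨0, hd⟩⟩
  let F : ℝ → ℝ := (Set.Iio r).indicator fun y => y ^ 2
  have h1 : ∫ x in Metric.ball x₀ r, ‖x - x₀‖ ^ 2 = ∫ x, F ‖x - x₀‖ := by
    rw [← integral_indicator Metric.isOpen_ball.measurableSet]
    refine integral_congr_ae (ae_of_all _ fun x => ?_)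
    simp only [F, Set.indicator, Metric.mem_ball, dist_eq_norm, Set.mem_Iio]
  rw [h1, integral_sub_right_eq_self (fun x => F ‖x‖), integral_fun_norm_addHaar,
    finrank_euclideanSpace_fin]
  have h2 : ∫ y in Set.Ioi 0, y ^ (d - 1) • F y = r ^ (d + 2) / (d + 2) := by
    have e : (fun y => y ^ (d - 1) • F y) = (Set.Iio r).indicator fun y => y ^ (d + 1) := by
      funext y
      by_cases hy : y ∈ Set.Iio r
      · simp only [F, Set.indicator_of_mem hy, smul_eq_mul, ← pow_add]
        congr 1
        omega
      · simp only [F, Set.indicator_of_notMem hy, smul_zero]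
    rw [e, setIntegral_indicator measurableSet_Iio, Set.Ioi_inter_Iio, ← integral_Ioc_eq_integral_Ioo,
      ← intervalIntegral.integral_of_le hr.le, integral_pow]
    push_cast
    ring
  rw [h2, nsmul_eq_mul, smul_eq_mul]
  ring

/-- The paraboloid is, up to scaling, the torsion function of the ball, which maximizes the integral
relative to the Dirichlet norm. Composing with the smooth positive part gives compact support, and
the slope bound keeps the gradient below that of the paraboloid. -/
theorem exists_radial_testFunction {d : ℕ} (x₀ : EuclideanSpace ℝ (Fin d)) {r : ℝ} (hr : 0 < r)
    {ε : ℝ} (hε : 0 < ε) :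
    ∃ φ : EuclideanSpace ℝ (Fin d) → ℝ, IsTestFunction (Metric.ball x₀ r) φ ∧
      (∀ x, r ^ 2 - ‖x - x₀‖ ^ 2 - 2 * ε ≤ φ x) ∧
      ∀ x, ∑ i, partialDeriv i φ x ^ 2 ≤ 4 * ‖x - x₀‖ ^ 2 := by
  obtain ⟨g, g', hg, hg', hb, h0, hlow⟩ := exists_smooth_posPart hε
  have hsub : tsupport (fun x => g (r ^ 2 - ‖x - x₀‖ ^ 2)) ⊆ Metric.ball x₀ r := by
    have hcl : IsClosed {x : EuclideanSpace ℝ (Fin d) | ε ≤ r ^ 2 - ‖x - x₀‖ ^ 2} :=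
      isClosed_le continuous_const (by fun_prop)
    refine (closure_minimal (fun x hx => ?_) hcl).trans fun x hx => ?_
    · by_contra h
      exact hx (h0 _ (not_le.1 h).le)
    · rw [Metric.mem_ball, dist_eq_norm]
      have hx' : ε ≤ r ^ 2 - ‖x - x₀‖ ^ 2 := hx
      exact lt_of_pow_lt_pow_left₀ 2 hr.le (by linarith)
  refine ⟨fun x => g (r ^ 2 - ‖x - x₀‖ ^ 2), ⟨?_, ?_, hsub⟩, fun x => hlow _, fun x => ?_⟩
  · exact hg.comp (contDiff_const.sub ((contDiff_id.sub contDiff_const).norm_sq ℝ))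
  · exact (isCompact_closedBall x₀ r).of_isClosed_subset (isClosed_tsupport _)
      (hsub.trans Metric.ball_subset_closedBall)
  · have hD : HasFDerivAt (fun x => r ^ 2 - ‖x - x₀‖ ^ 2) _ x :=
      (((hasFDerivAt_id x).sub_const x₀).norm_sq).const_sub (r ^ 2)
    have hp : ∀ i, partialDeriv i (fun x => g (r ^ 2 - ‖x - x₀‖ ^ 2)) x =
        g' (r ^ 2 - ‖x - x₀‖ ^ 2) * (-2 * (x - x₀) i) := fun i => by
      have := ((hg' (r ^ 2 - ‖x - x₀‖ ^ 2)).comp_hasFDerivAt x hD).fderiv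
      rw [partialDeriv]
      erw [this]
      simp [EuclideanSpace.inner_single_right]
    simp_rw [hp, EuclideanSpace.norm_sq_eq, Real.norm_eq_abs, sq_abs, Finset.mul_sum]
    refine Finset.sum_le_sum fun i _ => ?_
    rw [mul_pow]
    refine (mul_le_of_le_one_left (sq_nonneg _) (hb _)).trans_eq (by ring)

/-- This is the test with the paraboloid itself, reached by letting `ε` tend to `0` in the smoothed
version. -/
theorem IsDirichletSolution.abs_mul_le_of_ball_subset {d : ℕ}
    {Ω : Set (EuclideanSpace ℝ (Fin d))} (hΩ : IsOpen Ω) {u : EuclideanSpace ℝ (Fin d) → ℝ}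
    {c : ℝ} (hu : IsDirichletSolution Ω 1 u fun _ => c) {x₀ : EuclideanSpace ℝ (Fin d)} {r : ℝ}
    (hr : 0 < r) (hball : Metric.ball x₀ r ⊆ Ω) :
    |c| * (r ^ 2 * volume.real (Metric.ball x₀ r) - ∫ x in Metric.ball x₀ r, ‖x - x₀‖ ^ 2) ≤
      sobolevSeminorm Ω 1 u * √(4 * ∫ x in Metric.ball x₀ r, ‖x - x₀‖ ^ 2) := by
  set V := volume.real (Metric.ball x₀ r)
  set J := ∫ x in Metric.ball x₀ r, ‖x - x₀‖ ^ 2 with hJ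
  have hV : 0 ≤ V := measureReal_nonneg
  have key : ∀ ε : ℝ, 0 < ε → |c| * (r ^ 2 * V - J - 2 * ε * V) ≤
      sobolevSeminorm Ω 1 u * √(4 * J) := by
    intro ε hε
    obtain ⟨φ, hφ, hlow, hgrad⟩ := exists_radial_testFunction x₀ hr hε
    have htest := hu.abs_integral_mul_le hΩ (φ := φ) ⟨hφ.1, hφ.2.1, hφ.2.2.trans hball⟩
    have hcn : Continuous fun x : EuclideanSpace ℝ (Fin d) => ‖x - x₀‖ ^ 2 := by fun_prop
    have hnint : IntegrableOn (fun x => ‖x - x₀‖ ^ 2) (Metric.ball x₀ r) :=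
      hcn.integrableOn_of_isBounded Metric.isBounded_ball
    have hleft : r ^ 2 * V - J - 2 * ε * V ≤ ∫ x in Ω, φ x := by
      have e1 : ∫ x in Ω, φ x = ∫ x in Metric.ball x₀ r, φ x := by
        rw [setIntegral_eq_integral_of_forall_compl_eq_zero,
          setIntegral_eq_integral_of_forall_compl_eq_zero]
        · exact fun x hx => image_eq_zero_of_notMem_tsupport fun h => hx (hφ.2.2 h)
        · exact fun x hx => image_eq_zero_of_notMem_tsupport fun h => hx (hball (hφ.2.2 h))
      have e2 : ∫ x in Metric.ball x₀ r, (r ^ 2 - 2 * ε - ‖x - x₀‖ ^ 2) =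
          r ^ 2 * V - J - 2 * ε * V := by
        have hcint : IntegrableOn (fun _ => r ^ 2 - 2 * ε) (Metric.ball x₀ r) :=
          continuous_const.integrableOn_of_isBounded Metric.isBounded_ball
        rw [integral_sub hcint hnint,
          setIntegral_const, smul_eq_mul]
        ring
      rw [e1, ← e2]
      refine setIntegral_mono (continuous_const.sub hcn |>.integrableOn_of_isBounded
        Metric.isBounded_ball) (hφ.1.continuous.integrableOn_of_isBounded Metric.isBounded_ball)
        fun x => ?_
      linarith [hlow x]
    have hright : ∑ σ ∈ multiIndices d 1, ∫ x, mixedDeriv σ φ x ^ 2 ≤ 4 * J := by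
      rw [sum_multiIndices_one fun σ => ∫ x, mixedDeriv σ φ x ^ 2]
      simp_rw [mixedDeriv_single]
      have hi : ∀ i, Integrable fun x => partialDeriv i φ x ^ 2 := fun i =>
        ((hφ.1.partialDeriv i).continuous.memLp_of_hasCompactSupport
          (hφ.2.1.partialDeriv i) (p := 2)).integrable_sq
      rw [← integral_finsetSum _ fun i _ => hi i, hJ, ← integral_const_mul,
        ← setIntegral_eq_integral_of_forall_compl_eq_zero (s := Metric.ball x₀ r)]
      · exact setIntegral_mono (integrable_finsetSum _ fun i _ => (hi i).integrableOn)
          (hnint.const_mul 4) hgrad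
      · intro x hx
        refine Finset.sum_eq_zero fun i _ => ?_
        rw [image_eq_zero_of_notMem_tsupport fun h =>
          hx (hφ.2.2 (tsupport_partialDeriv_subset φ i h)), sq, zero_mul]
    rw [integral_const_mul, abs_mul] at htest
    calc |c| * (r ^ 2 * V - J - 2 * ε * V) ≤ |c| * |∫ x in Ω, φ x| :=
          mul_le_mul_of_nonneg_left (hleft.trans (le_abs_self _)) (abs_nonneg c)
      _ ≤ _ := htest
      _ ≤ _ := mul_le_mul_of_nonneg_left (Real.sqrt_le_sqrt hright) (Real.sqrt_nonneg _)
  have ht : Tendsto (fun ε : ℝ => |c| * (r ^ 2 * V - J - 2 * ε * V)) (𝓝[>] 0)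
      (𝓝 (|c| * (r ^ 2 * V - J - 2 * 0 * V))) :=
    (Continuous.tendsto (by fun_prop) 0).mono_left nhdsWithin_le_nhds
  rw [mul_zero, zero_mul, sub_zero] at ht
  exact le_of_tendsto ht (eventually_nhdsWithin_of_forall key)

theorem l2Norm_const_le_mul_sobolevSeminorm {d : ℕ} (hd : 1 ≤ d) {δ h : ℝ} (hδ : 0 < δ)
    (hh : 0 < h) {Ω : Set (EuclideanSpace ℝ (Fin d))} (hΩ : IsOpen Ω)
    (hbdd : Bornology.IsBounded Ω) (hdiam : Metric.diam Ω ≤ h) {x₀ : EuclideanSpace ℝ (Fin d)}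
    (hball : Metric.ball x₀ (δ * h / 2) ⊆ Ω) {u : EuclideanSpace ℝ (Fin d) → ℝ} {c : ℝ}
    (hu : IsDirichletSolution Ω 1 u fun _ => c) :
    l2Norm Ω (fun _ => c) ≤
      2 * √((d : ℝ) * ((d : ℝ) + 2)) * δ ^ (-1 - (d : ℝ) / 2) * (h ^ 1)⁻¹ *
        sobolevSeminorm Ω 1 u := by
  have : Nonempty (Fin d) := ⟨⟨0, hd⟩⟩
  have hr : 0 < δ * h / 2 := by positivity
  set r := δ * h / 2 with hrdef
  set κ := volume.real (Metric.ball (0 : EuclideanSpace ℝ (Fin d)) 1) with hκ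
  set U := sobolevSeminorm Ω 1 u with hUdef
  have hU : 0 ≤ U := Real.sqrt_nonneg _
  have hκ0 : 0 < κ := 
    ENNReal.toReal_pos (Metric.measure_ball_pos _ _ one_pos).ne'
      Metric.isBounded_ball.measure_lt_top.ne
  have hd0 : (0 : ℝ) < d := by exact_mod_cast hd
  have hV : volume.real (Metric.ball x₀ r) = r ^ d * κ := by
    rw [Measure.real, Measure.addHaar_ball _ _ hr.le, ENNReal.toReal_mul,
      ENNReal.toReal_ofReal (by positivity), finrank_euclideanSpace_fin]
    rfl
  -- The inclusion of `Ω` in a ball of radius `h` would cost a factor `2 ^ d` here; the isodiametric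
  -- inequality avoids it.
  have hvol : volume.real Ω ≤ (h / 2) ^ d * κ := by
    have h1 := volume_le_volume_closedBall_half hΩ.measurableSet hh.le fun x hx y hy =>
      (Metric.dist_le_diam_of_mem hbdd hx hy).trans hdiam
    have h2 := ENNReal.toReal_mono Metric.isBounded_closedBall.measure_lt_top.ne h1
    rwa [Measure.addHaar_closedBall _ _ (by positivity), ENNReal.toReal_mul,
      ENNReal.toReal_ofReal (by positivity), finrank_euclideanSpace_fin] at h2
  have key := hu.abs_mul_le_of_ball_subset hΩ hr hball
  rw [setIntegral_ball_dist_sq hd x₀ hr, hV] at key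
  have hM : r ^ 2 * (r ^ d * κ) - κ * (d / (d + 2)) * r ^ (d + 2) =
      2 * κ * r ^ (d + 2) / (d + 2) := by
    field_simp
    ring
  rw [hM] at key
  have hsq := pow_le_pow_left₀ (by positivity) key 2
  rw [mul_pow, mul_pow, sq_abs, Real.sq_sqrt (by positivity)] at hsq
  -- Squaring `key` leaves a common factor `4 * (κ * r ^ (d + 2)) / (d + 2) ^ 2` on both sides.
  have h1 : c ^ 2 * (κ * r ^ (d + 2)) ≤ U ^ 2 * (d * (d + 2)) := by
    have hpos : 0 < 4 * (κ * r ^ (d + 2)) / ((d : ℝ) + 2) ^ 2 := by positivity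
    refine le_of_mul_le_mul_right (le_trans (le_of_eq ?_) (hsq.trans_eq ?_)) hpos
    · field_simp
      ring
    · rw [← hκ, ← hUdef]
      field_simp
  have hrd : r ^ (d + 2) = δ ^ (d + 2) * (h / 2) ^ d * (h / 2) ^ 2 := by
    rw [hrdef, mul_div_assoc, mul_pow, mul_assoc, ← pow_add]
  have h2 : c ^ 2 * volume.real Ω * (δ ^ (d + 2) * (h / 2) ^ 2) ≤ U ^ 2 * (d * (d + 2)) := by
    refine le_trans ?_ h1
    calc c ^ 2 * volume.real Ω * (δ ^ (d + 2) * (h / 2) ^ 2)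
        ≤ c ^ 2 * ((h / 2) ^ d * κ) * (δ ^ (d + 2) * (h / 2) ^ 2) := by gcongr
      _ = _ := by rw [hrd]; ring
  have hδd : (δ ^ (-1 - (d : ℝ) / 2)) ^ 2 = (δ ^ (d + 2))⁻¹ := by
    rw [← Real.rpow_natCast, ← Real.rpow_mul hδ.le, ← Real.rpow_natCast, ← Real.rpow_neg hδ.le]
    congr 1
    push_cast
    ring
  rw [l2Norm, setIntegral_const, smul_eq_mul]
  refine Real.sqrt_le_iff.2 ⟨by positivity, ?_⟩
  rw [mul_pow, mul_pow, mul_pow, mul_pow, hδd, Real.sq_sqrt (by positivity)]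
  rw [← le_div_iff₀ (by positivity)] at h2
  rw [mul_comm]
  refine h2.trans_eq ?_
  field_simp

/-! ### Choice of the constant -/

theorem mainTheorem8 :
    ∃ C : ℕ → ℕ → ℕ → ℝ → ℝ,
      (∀ (k s d : ℕ) (δ : ℝ), 1 ≤ d → 0 < δ → 0 < C k s d δ) ∧
      (∀ (d : ℕ) (δ : ℝ), 1 ≤ d → 0 < δ →
        C 1 1 d δ = 2 * Real.sqrt ((d : ℝ) * ((d : ℝ) + 2)) * δ ^ (-1 - (d : ℝ) / 2)) ∧
      ∀ (k s d : ℕ) (δ h : ℝ), 1 ≤ d → 0 < δ → 0 < h →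
        ∀ Ω : Set (EuclideanSpace ℝ (Fin d)), IsOpen Ω → Bornology.IsBounded Ω →
          Metric.diam Ω ≤ h →
          ∀ x₀ : EuclideanSpace ℝ (Fin d), Metric.ball x₀ (δ * h / 2) ⊆ Ω →
            ∀ p : MvPolynomial (Fin d) ℝ, p.totalDegree < s →
              ∀ u : EuclideanSpace ℝ (Fin d) → ℝ,
                IsDirichletSolution Ω k u (fun x => MvPolynomial.eval (fun i => x i) p) →
                l2Norm Ω (fun x => MvPolynomial.eval (fun i => x i) p) ≤
                  C k s d δ * (h ^ k)⁻¹ * sobolevSeminorm Ω k u := by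
  choose C₀ hC₀ hbound using fun (k s d : ℕ) (δ : {δ : ℝ // 0 < δ}) =>
    exists_l2Norm_le_mul_sobolevSeminorm k s d δ.2
  refine ⟨fun k s d δ => if k = 1 ∧ s = 1 then
      2 * √((d : ℝ) * ((d : ℝ) + 2)) * δ ^ (-1 - (d : ℝ) / 2)
    else if hδ : 0 < δ then C₀ k s d ⟨δ, hδ⟩ else 0, ?_, ?_, ?_⟩
  · intro k s d δ hd hδ
    have hd0 : (0 : ℝ) < d := by exact_mod_cast hd
    dsimp only
    split_ifs
    · positivity
    · exact hC₀ k s d ⟨δ, hδ⟩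
  · intro d δ _ _
    simp
  · intro k s d δ h hd hδ hh Ω hΩ hbdd hdiam x₀ hball p hp u hu
    dsimp only
    split_ifs with hks
    · obtain ⟨rfl, rfl⟩ := hks
      -- With `s = 1` the degree is `0`, so `p` is a constant.
      rw [MvPolynomial.totalDegree_eq_zero_iff_eq_C.1 (Nat.lt_one_iff.1 hp)] at hu ⊢
      simp only [MvPolynomial.eval_C] at hu ⊢
      exact l2Norm_const_le_mul_sobolevSeminorm hd hδ hh hΩ hbdd hdiam hball hu
    · exact hbound k s d ⟨δ, hδ⟩ h hh Ω hΩ hbdd hdiam x₀ hball p hp u hu
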